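/- Let $R$ be a commutative ring with $1$, let $A$ and $B$ be ideals of $R$, let $n\ge 3$, and let $(B:A)=\{x\in R\mid xA\subseteq B\}$ be the ideal quotient. Put $[x,y]=xyx^{-1}y^{-1}$, and for subgroups $F,H$ of a group $G$ let $[F,H]$ be the subgroup generated by all $[f,h]$ with $f\in F$, $h\in H$, and let $C_G(F,H)=\{g\in G\mid [f,g]\in H \text{ for all } f\in F\}$ be the centraliser of $F$ modulo $H$. For an ideal $I$ of $R$ let $E(n,I)\le \mathrm{GL}(n,R)$ be the subgroup generated by all elementary transvections $t_{ij}(\xi)=e+\xi e_{ij}$ with $\xi\in I$, $1\le i\ne j\le n$; let $E(n,R,I)$ be the normal closure of $E(n,I)$ in $E(n,R)$; and let the full congruence subgroup $C(n,R,I)$ be the full preimage of the centre of $\mathrm{GL}(n,R/I)$ under reduction modulo $I$, $\mathrm{GL}(n,R)\to\mathrm{GL}(n,R/I)$. Then $$C_{\mathrm{GL}(n,R)}\bigl(E(n,R,A),\,[E(n,R,(B:A)),E(n,R,A)]\bigr)=C(n,R,(B:A)).$$ -/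

import Mathlib

/-- The centraliser `C_G(F, H) = {g ∈ G | ∀ f ∈ F, [f, g] ∈ H}` of a subgroup `F` modulo a
subgroup `H`, where `[x, y] = x * y * x⁻¹ * y⁻¹`. As `H` need not be normal, this is a set. -/
def centraliserMod {G : Type*} [Group G] (F H : Subgroup G) : Set G :=
  {g | ∀ f ∈ F, f * g * f⁻¹ * g⁻¹ ∈ H}

/-- The elementary transvection `t_ij(ξ) = e + ξ e_ij`, `i ≠ j`, as an element of `GL(n, R)`. -/
def elemTransvection {R : Type*} [CommRing R] {n : ℕ} (i j : Fin n) (hij : i ≠ j) (ξ : R) :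
    Matrix.GeneralLinearGroup (Fin n) R where
  val := Matrix.transvection i j ξ
  inv := Matrix.transvection i j (-ξ)
  val_inv := by rw [Matrix.transvection_mul_transvection_same i j hij]; simp
  inv_val := by rw [Matrix.transvection_mul_transvection_same i j hij]; simp

/-- The elementary subgroup `E(n, I)` of `GL(n, R)`, generated by all elementary transvections
`t_ij(ξ)` with `ξ ∈ I`. The absolute elementary subgroup `E(n, R)` is the case `I = ⊤`. -/
def elemSubgroup {R : Type*} [CommRing R] (n : ℕ) (I : Ideal R) :
    Subgroup (Matrix.GeneralLinearGroup (Fin n) R) :=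
  Subgroup.closure {g | ∃ (i j : Fin n) (hij : i ≠ j), ∃ ξ ∈ I, g = elemTransvection i j hij ξ}

/-- The relative elementary subgroup `E(n, R, I)`: the normal closure of `E(n, I)` in the
absolute elementary subgroup `E(n, R)`, that is, the subgroup of `GL(n, R)` generated by the
conjugates `x h x⁻¹` with `x ∈ E(n, R)` and `h ∈ E(n, I)`. -/
def relElemSubgroup {R : Type*} [CommRing R] (n : ℕ) (I : Ideal R) :
    Subgroup (Matrix.GeneralLinearGroup (Fin n) R) :=
  Subgroup.closure
    {g | ∃ x ∈ elemSubgroup n (⊤ : Ideal R), ∃ h ∈ elemSubgroup n I, g = x * h * x⁻¹}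

/-- The full congruence subgroup `C(n, R, I)`: the full preimage of the centre of
`GL(n, R / I)` under the reduction homomorphism `GL(n, R) → GL(n, R / I)`. -/
def fullCongruenceSubgroup {R : Type*} [CommRing R] (n : ℕ) (I : Ideal R) :
    Subgroup (Matrix.GeneralLinearGroup (Fin n) R) :=
  (Subgroup.center (Matrix.GeneralLinearGroup (Fin n) (R ⧸ I))).comap
    (Matrix.GeneralLinearGroup.map (Ideal.Quotient.mk I))

/-! Write I = (B:A). If g is in the centraliser, its commutators with t_ij(a), a ∈ A, lie in
GL(n,R,B), because AI ⊆ B; hence a(e_ij g − g e_ij) ≡ 0 mod B for all a ∈ A, so g commutes with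
every e_ij, i ≠ j, modulo I and is scalar there. The converse is the birelative commutator formula
[C(n,R,I), E(n,R,A)] ≤ [E(n,R,I), E(n,R,A)]. The three subgroups lemma, with E(n,R,A) ≤ [E(n,R),
E(n,R,A)], reduces it to the absolute formula [C(n,R,I), E(n,R)] ≤ E(n,R,I). That in turn reduces to
[GL(n,R,I), E(n,R)] ≤ E(n,R,I), proved by Suslin's method: a conjugate of a transvection is e + uv
with u unimodular and vu = 0, and such matrices factor explicitly. -/

open Matrix
open scoped commutatorElement

/-! ### Matrices e + uv with vu = 0 -/

section RankOne

variable {R : Type*} [CommRing R] {n : ℕ}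

/-- The matrix `e + u v` attached to a column `u` and a row `v` with `v u = 0`. -/
def rankOneGL (u v : Fin n → R) (h : v ⬝ᵥ u = 0) : GL (Fin n) R where
  val := 1 + vecMulVec u v
  inv := 1 - vecMulVec u v
  val_inv := by
    simp [mul_sub, add_mul, vecMulVec_mul_vecMulVec, h]
  inv_val := by
    simp [mul_add, sub_mul, vecMulVec_mul_vecMulVec, h]

theorem rankOneGL_congr {u u' v v' : Fin n → R} (hu : u = u') (hv : v = v') (h : v ⬝ᵥ u = 0) :
    rankOneGL u v h = rankOneGL u' v' (hu ▸ hv ▸ h) := by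
  subst hu hv
  rfl

theorem rankOneGL_add_right (u v v' : Fin n → R) (h : v ⬝ᵥ u = 0) (h' : v' ⬝ᵥ u = 0) :
    rankOneGL u (v + v') (by rw [add_dotProduct, h, h', add_zero]) =
      rankOneGL u v h * rankOneGL u v' h' := by
  ext1
  simp only [rankOneGL, Units.val_mul, mul_add, add_mul, vecMulVec_mul_vecMulVec, h, vecMulVec_add]
  simp [add_assoc]

theorem rankOneGL_add_left (u u' v : Fin n → R) (h : v ⬝ᵥ u = 0) (h' : v ⬝ᵥ u' = 0) :
    rankOneGL (u + u') v (by rw [dotProduct_add, h, h', add_zero]) =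
      rankOneGL u v h * rankOneGL u' v h' := by
  ext1
  simp only [rankOneGL, Units.val_mul, mul_add, add_mul, vecMulVec_mul_vecMulVec, h', add_vecMulVec]
  simp
  abel

theorem rankOneGL_smul_left (c : R) (u v : Fin n → R) (h : v ⬝ᵥ u = 0) :
    rankOneGL (c • u) v (by rw [dotProduct_smul, h, smul_zero]) =
      rankOneGL u (c • v) (by rw [smul_dotProduct, h, smul_zero]) := by
  ext1
  simp [rankOneGL]

theorem rankOneGL_inv_right (u v : Fin n → R) (h : v ⬝ᵥ u = 0) :
    (rankOneGL u v h)⁻¹ = rankOneGL u (-v) (by rw [neg_dotProduct, h, neg_zero]) := by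
  ext1
  change 1 - vecMulVec u v = 1 + vecMulVec u (-v)
  rw [vecMulVec_neg, sub_eq_add_neg]

theorem rankOneGL_inv_left (u v : Fin n → R) (h : v ⬝ᵥ u = 0) :
    (rankOneGL u v h)⁻¹ = rankOneGL (-u) v (by rw [dotProduct_neg, h, neg_zero]) := by
  ext1
  change 1 - vecMulVec u v = 1 + vecMulVec (-u) v
  rw [neg_vecMulVec, sub_eq_add_neg]

theorem rankOneGL_zero_right (u : Fin n → R) (h : (0 : Fin n → R) ⬝ᵥ u = 0) :
    rankOneGL u 0 h = 1 := by
  ext1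
  simp [rankOneGL]

theorem rankOneGL_zero_left (v : Fin n → R) (h : v ⬝ᵥ 0 = 0) : rankOneGL 0 v h = 1 := by
  ext1
  simp [rankOneGL]

theorem conj_rankOneGL (g : GL (Fin n) R) (u v : Fin n → R) (h : v ⬝ᵥ u = 0) :
    g * rankOneGL u v h * g⁻¹ =
      rankOneGL ((g : Matrix (Fin n) (Fin n) R) *ᵥ u)
        (v ᵥ* ((g⁻¹ : GL (Fin n) R) : Matrix (Fin n) (Fin n) R))
        (by rw [dotProduct_mulVec, vecMul_vecMul, ← Units.val_mul]; simpa using h) := by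
  ext1
  simp only [rankOneGL, Units.val_mul, mul_add, add_mul, mul_vecMulVec, vecMulVec_mul, mul_one]
  rw [← Units.val_mul, mul_inv_cancel, Units.val_one]

/-- Routing through a free index m splits a general e + uv into two factors, each a product of
elementary transvections. -/
theorem commutator_rankOneGL (u v : Fin n → R) (m : Fin n) (hu : u m = 0) (hv : v m = 0)
    (h : v ⬝ᵥ u = 0) :
    ⁅rankOneGL u (Pi.single m 1) (by simpa using hu),
      rankOneGL (Pi.single m 1) v (by simpa using hv)⁆ = rankOneGL u v h := by
  have h2 : v ⬝ᵥ Pi.single m 1 = 0 := by simpa using hv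
  rw [commutatorElement_def, mul_inv_eq_iff_eq_mul, mul_inv_eq_iff_eq_mul]
  ext1
  simp only [rankOneGL, Units.val_mul, mul_add, add_mul, vecMulVec_mul_vecMulVec, h2]
  simp [vecMulVec_mul_vecMulVec, h]
  abel

theorem elemTransvection_eq_rankOneGL (i j : Fin n) (hij : i ≠ j) (ξ : R) :
    elemTransvection i j hij ξ =
      rankOneGL (Pi.single i 1) (Pi.single j ξ) (by simp [hij]) := by
  ext1
  change transvection i j ξ = 1 + vecMulVec _ _
  have h : (Pi.single j ξ : Fin n → R) = ξ • Pi.single j 1 := by rw [← Pi.single_smul]; simp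
  rw [h, vecMulVec_smul, ← single_eq_single_vecMulVec_single, smul_single]
  simp [transvection]

/-- The rows `v` with `v u = 0` and `e + u v ∈ H`. -/
def rankOneRows (H : Subgroup (GL (Fin n) R)) (u : Fin n → R) : AddSubgroup (Fin n → R) where
  carrier := {v | ∃ h : v ⬝ᵥ u = 0, rankOneGL u v h ∈ H}
  zero_mem' := ⟨zero_dotProduct u, by rw [rankOneGL_zero_right]; exact one_mem H⟩
  add_mem' := fun ⟨h, hv⟩ ⟨h', hv'⟩ =>
    ⟨by rw [add_dotProduct, h, h', add_zero], by
      rw [rankOneGL_add_right _ _ _ h h']; exact mul_mem hv hv'⟩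
  neg_mem' := fun ⟨h, hv⟩ => ⟨by rw [neg_dotProduct, h, neg_zero], by
      rw [← rankOneGL_inv_right _ _ h]; exact inv_mem hv⟩

/-- The columns `u` with `v u = 0` and `e + u v ∈ H`. -/
def rankOneCols (H : Subgroup (GL (Fin n) R)) (v : Fin n → R) : AddSubgroup (Fin n → R) where
  carrier := {u | ∃ h : v ⬝ᵥ u = 0, rankOneGL u v h ∈ H}
  zero_mem' := ⟨dotProduct_zero v, by rw [rankOneGL_zero_left]; exact one_mem H⟩
  add_mem' := fun ⟨h, hv⟩ ⟨h', hv'⟩ =>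
    ⟨by rw [dotProduct_add, h, h', add_zero], by
      rw [rankOneGL_add_left _ _ _ h h']; exact mul_mem hv hv'⟩
  neg_mem' := fun ⟨h, hv⟩ => ⟨by rw [dotProduct_neg, h, neg_zero], by
      rw [← rankOneGL_inv_left _ _ h]; exact inv_mem hv⟩

theorem elemTransvection_mem_elemSubgroup {I : Ideal R} (i j : Fin n) (hij : i ≠ j) {ξ : R}
    (hξ : ξ ∈ I) : elemTransvection i j hij ξ ∈ elemSubgroup n I :=
  Subgroup.subset_closure ⟨i, j, hij, ξ, hξ, rfl⟩

theorem rankOneGL_single_left_mem_elemSubgroup {I : Ideal R} (m : Fin n) (v : Fin n → R)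
    (h : v ⬝ᵥ Pi.single m 1 = 0) (hI : ∀ k, v k ∈ I) :
    rankOneGL (Pi.single m 1) v h ∈ elemSubgroup n I := by
  have key : v ∈ rankOneRows (elemSubgroup n I) (Pi.single m 1) := by
    rw [← Finset.univ_sum_single v]
    refine sum_mem fun k _ => ?_
    by_cases hk : m = k
    · subst hk
      have h0 : v m = 0 := by simpa using h
      rw [h0, Pi.single_zero]
      exact zero_mem _
    · refine ⟨by simp [hk], ?_⟩
      rw [← elemTransvection_eq_rankOneGL m k hk]
      exact elemTransvection_mem_elemSubgroup _ _ hk (hI k)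
  exact key.2

theorem rankOneGL_single_right_mem_elemSubgroup {I : Ideal R} (m : Fin n) (u : Fin n → R)
    (h : Pi.single m 1 ⬝ᵥ u = 0) (hI : ∀ k, u k ∈ I) :
    rankOneGL u (Pi.single m 1) h ∈ elemSubgroup n I := by
  have key : u ∈ rankOneCols (elemSubgroup n I) (Pi.single m 1) := by
    rw [← Finset.univ_sum_single u]
    refine sum_mem fun k _ => ?_
    by_cases hk : k = m
    · subst hk
      have h0 : u k = 0 := by simpa using h
      rw [h0, Pi.single_zero]
      exact zero_mem _
    · refine ⟨by simp [hk], ?_⟩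
      have h1 : (Pi.single k (u k) : Fin n → R) = u k • Pi.single k 1 := by
        rw [← Pi.single_smul]; simp
      have h2 : (u k • Pi.single m 1 : Fin n → R) = Pi.single m (u k) := by
        rw [← Pi.single_smul]; simp
      rw [rankOneGL_congr h1 rfl, rankOneGL_smul_left _ _ _ (by simp [hk]),
        rankOneGL_congr rfl h2, ← elemTransvection_eq_rankOneGL k m hk]
      exact elemTransvection_mem_elemSubgroup _ _ hk (hI k)
  exact key.2

end RankOne

/-! ### Relative elementary subgroups and Suslin's normality theorem -/

section Relative

variable {R : Type*} [CommRing R] {n : ℕ}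

theorem elemSubgroup_mono {I J : Ideal R} (h : I ≤ J) : elemSubgroup n I ≤ elemSubgroup n J :=
  Subgroup.closure_mono fun _ ⟨i, j, hij, ξ, hξ, hg⟩ => ⟨i, j, hij, ξ, h hξ, hg⟩

theorem elemSubgroup_le_relElemSubgroup (I : Ideal R) :
    elemSubgroup n I ≤ relElemSubgroup n I := fun h hh =>
  Subgroup.subset_closure ⟨1, one_mem _, h, hh, by simp⟩

theorem relElemSubgroup_le_elemSubgroup_top (I : Ideal R) :
    relElemSubgroup n I ≤ elemSubgroup n (⊤ : Ideal R) := by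
  refine (Subgroup.closure_le _).2 ?_
  rintro _ ⟨x, hx, h, hh, rfl⟩
  exact mul_mem (mul_mem hx (elemSubgroup_mono le_top hh)) (inv_mem hx)

theorem relElemSubgroup_top : relElemSubgroup n (⊤ : Ideal R) = elemSubgroup n ⊤ :=
  le_antisymm (relElemSubgroup_le_elemSubgroup_top _) (elemSubgroup_le_relElemSubgroup _)

theorem conj_mem_relElemSubgroup {I : Ideal R} {x y : GL (Fin n) R}
    (hx : x ∈ elemSubgroup n (⊤ : Ideal R)) (hy : y ∈ relElemSubgroup n I) :
    x * y * x⁻¹ ∈ relElemSubgroup n I := by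
  have : relElemSubgroup n I ≤ (relElemSubgroup n I).comap (MulAut.conj x).toMonoidHom := by
    refine (Subgroup.closure_le _).2 ?_
    rintro _ ⟨z, hz, h, hh, rfl⟩
    refine Subgroup.subset_closure ⟨x * z, mul_mem hx hz, h, hh, ?_⟩
    simp [mul_assoc]
  exact this hy

/-- `e + u v` with `v` over `I` having a zero entry lies in `E(n, R, I)`. -/
theorem rankOneGL_mem_relElemSubgroup_of_apply_eq_zero {I : Ideal R} (u v : Fin n → R)
    (m : Fin n) (hv : v m = 0) (h : v ⬝ᵥ u = 0) (hI : ∀ k, v k ∈ I) :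
    rankOneGL u v h ∈ relElemSubgroup n I := by
  have hd : v ⬝ᵥ (u m • Pi.single m 1) = 0 := by simp [hv]
  have hd1 : v ⬝ᵥ Pi.single m 1 = 0 := by simp [hv]
  have hd' : v ⬝ᵥ (u - u m • Pi.single m 1) = 0 := by rw [dotProduct_sub, h, hd, sub_zero]
  have hm : (u - u m • Pi.single m (1 : R) : Fin n → R) m = 0 := by simp
  have hx := rankOneGL_single_right_mem_elemSubgroup (I := (⊤ : Ideal R)) m
    (u - u m • Pi.single m 1) (by simp) (fun _ => trivial)
  have hy := elemSubgroup_le_relElemSubgroup I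
    (rankOneGL_single_left_mem_elemSubgroup m v hd1 hI)
  have hz := elemSubgroup_le_relElemSubgroup I
    (rankOneGL_single_left_mem_elemSubgroup m (u m • v) (by simp [hv])
      fun k => I.mul_mem_left _ (hI k))
  -- Split off the m-th entry of u: the rest gives a commutator of E(n,R) with E(n,I), and the
  -- scalar u m moves over to v.
  rw [rankOneGL_congr (sub_add_cancel u (u m • Pi.single m 1)).symm rfl,
    rankOneGL_add_left _ _ _ hd' hd, rankOneGL_smul_left _ _ _ hd1,
    ← commutator_rankOneGL _ v m hm hv hd', commutatorElement_def]
  exact mul_mem (mul_mem (conj_mem_relElemSubgroup hx hy) (inv_mem hy)) hz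

/-- Syzygies of a unimodular column are generated by the Koszul ones. Each of these is supported on
two indices, so n ≥ 3 leaves a zero entry. -/
theorem sum_smul_sub_smul_eq {u v w : Fin n → R} (hw : w ⬝ᵥ u = 1) (hv : v ⬝ᵥ u = 0) :
    ∑ k, ∑ l, (v k * w l) • (u l • Pi.single k (1 : R) - u k • Pi.single l (1 : R)) = v := by
  simp only [dotProduct] at hw hv
  ext i
  simp only [Finset.sum_apply, Pi.smul_apply, Pi.sub_apply, smul_eq_mul, mul_sub,
    Finset.sum_sub_distrib, Pi.single_apply]
  simp only [mul_ite, mul_one, mul_zero, Finset.sum_ite_irrel, Finset.sum_ite_eq,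
    Finset.mem_univ, if_true, Finset.sum_const_zero]
  have h1 : ∑ l, v i * w l * u l = v i := by
    simp_rw [mul_assoc]
    rw [← Finset.mul_sum, hw, mul_one]
  have h2 : ∑ k, v k * w i * u k = 0 := by
    simp_rw [mul_right_comm _ (w i)]
    rw [← Finset.sum_mul, hv, zero_mul]
  rw [h1, h2, sub_zero]

theorem exists_ne_ne (hn : 3 ≤ n) (k l : Fin n) : ∃ m, m ≠ k ∧ m ≠ l := by
  obtain ⟨m, hm⟩ := Finset.exists_mem_notMem_of_card_lt_card
    (s := {k, l}) (t := (Finset.univ : Finset (Fin n))) (by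
      rw [Finset.card_univ, Fintype.card_fin]
      exact lt_of_le_of_lt Finset.card_le_two hn)
  exact ⟨m, by simpa using hm.2⟩

/-- `e + u v` with `u` unimodular and `v` over `I` lies in `E(n, R, I)`. -/
theorem rankOneGL_mem_relElemSubgroup (hn : 3 ≤ n) {I : Ideal R} (u v w : Fin n → R)
    (hw : w ⬝ᵥ u = 1) (h : v ⬝ᵥ u = 0) (hI : ∀ k, v k ∈ I) :
    rankOneGL u v h ∈ relElemSubgroup n I := by
  have key : v ∈ rankOneRows (relElemSubgroup n I) u := by
    rw [← sum_smul_sub_smul_eq hw h]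
    refine sum_mem fun k _ => sum_mem fun l _ => ?_
    obtain ⟨m, hmk, hml⟩ := exists_ne_ne hn k l
    have h0 : ((v k * w l) • (u l • Pi.single k (1 : R) - u k • Pi.single l (1 : R))) ⬝ᵥ u
        = 0 := by
      simp [sub_dotProduct, mul_comm]
    refine ⟨h0, rankOneGL_mem_relElemSubgroup_of_apply_eq_zero _ _ m (by simp [hmk, hml]) h0 ?_⟩
    intro i
    exact I.mul_mem_right _ (I.mul_mem_right _ (hI k))
  exact key.2

theorem inv_row_dotProduct_col (g : GL (Fin n) R) (i : Fin n) :
    (Pi.single i 1 ᵥ* ((g⁻¹ : GL (Fin n) R) : Matrix (Fin n) (Fin n) R)) ⬝ᵥ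
      ((g : Matrix (Fin n) (Fin n) R) *ᵥ Pi.single i 1) = 1 := by
  rw [dotProduct_mulVec, vecMul_vecMul, ← Units.val_mul]
  simp

/-- Suslin's normality theorem in relative form. -/
theorem relElemSubgroup_normal (hn : 3 ≤ n) (I : Ideal R) : (relElemSubgroup n I).Normal := by
  have h1 : ∀ g : GL (Fin n) R, ∀ h ∈ elemSubgroup n I, g * h * g⁻¹ ∈ relElemSubgroup n I := by
    intro g
    suffices elemSubgroup n I ≤ (relElemSubgroup n I).comap (MulAut.conj g).toMonoidHom from
      fun h hh => this hh
    refine (Subgroup.closure_le _).2 ?_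
    rintro _ ⟨i, j, hij, ξ, hξ, rfl⟩
    change g * _ * g⁻¹ ∈ relElemSubgroup n I
    rw [elemTransvection_eq_rankOneGL, conj_rankOneGL]
    refine rankOneGL_mem_relElemSubgroup hn _ _ _ (inv_row_dotProduct_col g i) _ fun k => ?_
    simpa using I.mul_mem_right _ hξ
  refine ⟨fun y hy g => ?_⟩
  have : relElemSubgroup n I ≤ (relElemSubgroup n I).comap (MulAut.conj g).toMonoidHom := by
    refine (Subgroup.closure_le _).2 ?_
    rintro _ ⟨z, hz, h, hh, rfl⟩
    have := h1 (g * z) h hh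
    change g * (z * h * z⁻¹) * g⁻¹ ∈ relElemSubgroup n I
    simpa [mul_assoc] using this
  exact this hy

end Relative

/-! ### Principal congruence subgroups commute with E(n,R) modulo E(n,R,I) -/

section Congruence

variable {R : Type*} [CommRing R] {n : ℕ}

/-- The principal congruence subgroup `GL(n, R, I)`. -/
def principalCongruenceSubgroup (n : ℕ) (I : Ideal R) : Subgroup (GL (Fin n) R) :=
  (Matrix.GeneralLinearGroup.map (Ideal.Quotient.mk I)).ker

theorem mk_mulVec_single {I : Ideal R} {g : GL (Fin n) R}
    (hg : g ∈ principalCongruenceSubgroup n I) (i k : Fin n) :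
    Ideal.Quotient.mk I (((g : Matrix (Fin n) (Fin n) R) *ᵥ Pi.single i 1) k) =
      if k = i then 1 else 0 := by
  have h := congrArg (fun x : GL (Fin n) (R ⧸ I) => x k i) (MonoidHom.mem_ker.1 hg)
  simp only [Matrix.GeneralLinearGroup.map_apply] at h
  simp [h, Matrix.one_apply]

theorem mk_single_vecMul {I : Ideal R} {g : GL (Fin n) R}
    (hg : g ∈ principalCongruenceSubgroup n I) (ξ : R) (j k : Fin n) :
    Ideal.Quotient.mk I ((Pi.single j ξ ᵥ* (g : Matrix (Fin n) (Fin n) R)) k) =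
      if k = j then Ideal.Quotient.mk I ξ else 0 := by
  have h := congrArg (fun x : GL (Fin n) (R ⧸ I) => x j k) (MonoidHom.mem_ker.1 hg)
  simp only [Matrix.GeneralLinearGroup.map_apply] at h
  simp [h, Matrix.one_apply, eq_comm]

/-- After corrections in E(n,R,I), both matrices become commutators through the same index m, with
factors that agree modulo E(n,R,I). -/
theorem rankOneGL_div_rankOneGL_single_mem_relElemSubgroup (hn : 3 ≤ n) {I : Ideal R}
    (u v w : Fin n → R) (i j : Fin n) (hij : i ≠ j) (ξ : R) (hw : w ⬝ᵥ u = 1) (h : v ⬝ᵥ u = 0)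
    (hu : ∀ k, Ideal.Quotient.mk I (u k) = if k = i then 1 else 0)
    (hv : ∀ k, Ideal.Quotient.mk I (v k) = if k = j then Ideal.Quotient.mk I ξ else 0) :
    rankOneGL u v h / rankOneGL (Pi.single i 1) (Pi.single j ξ) (by simp [hij]) ∈
      relElemSubgroup n I := by
  have := relElemSubgroup_normal hn I
  obtain ⟨m, hmi, hmj⟩ := exists_ne_ne hn i j
  -- A Koszul row: orthogonal to u, zero at m, and congruent to v modulo I since u ≡ e_i.
  obtain ⟨v', hv'⟩ : ∃ v' : Fin n → R,
      v' = ξ • (u i • Pi.single j (1 : R) - u j • Pi.single i (1 : R)) := ⟨_, rfl⟩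
  obtain ⟨u', hu'⟩ : ∃ u' : Fin n → R, u' = u - u m • Pi.single m (1 : R) := ⟨_, rfl⟩
  have hv'u : v' ⬝ᵥ u = 0 := by
    rw [hv']
    simp [sub_dotProduct, mul_comm]
  have hv'm : v' m = 0 := by
    rw [hv']
    simp [hmi, hmj]
  have hu'm : u' m = 0 := by
    rw [hu']
    simp
  have hv'e : v' ⬝ᵥ Pi.single m 1 = 0 := by simpa using hv'm
  have heu' : Pi.single m 1 ⬝ᵥ u' = 0 := by simpa using hu'm
  have hv's : v' ⬝ᵥ (u m • Pi.single m 1) = 0 := by rw [dotProduct_smul, hv'e, smul_zero]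
  have hv'u' : v' ⬝ᵥ u' = 0 := by rw [hu', dotProduct_sub, hv'u, hv's, sub_zero]
  have hvv' : (v - v') ⬝ᵥ u = 0 := by rw [sub_dotProduct, h, hv'u, sub_zero]
  have hum : u m ∈ I := by
    rw [← Ideal.Quotient.eq_zero_iff_mem, hu, if_neg hmi]
  have f1 : rankOneGL u (v - v') hvv' ∈ relElemSubgroup n I := by
    refine rankOneGL_mem_relElemSubgroup hn _ _ w hw _ fun k => ?_
    rw [← Ideal.Quotient.eq_zero_iff_mem, hv']
    simp [hv, hu, Pi.single_apply, hij.symm, apply_ite (Ideal.Quotient.mk I)]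
  have f2 : rankOneGL (u m • Pi.single m 1) v' hv's ∈ relElemSubgroup n I := by
    rw [rankOneGL_smul_left _ _ _ hv'e]
    exact elemSubgroup_le_relElemSubgroup I (rankOneGL_single_left_mem_elemSubgroup _ _ _
      fun k => I.mul_mem_right _ hum)
  have hie : (Pi.single m 1 : Fin n → R) ⬝ᵥ Pi.single i 1 = 0 := by simp [hmi]
  have hej : (Pi.single j ξ : Fin n → R) ⬝ᵥ Pi.single m 1 = 0 := by simp [hmj.symm]
  have hiu : (Pi.single m 1 : Fin n → R) ⬝ᵥ (u' - Pi.single i 1) = 0 := by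
    rw [dotProduct_sub, heu', hie, sub_zero]
  have hvj : (v' - Pi.single j ξ) ⬝ᵥ Pi.single m 1 = 0 := by
    rw [sub_dotProduct, hv'e, hej, sub_zero]
  have f3 : rankOneGL (u' - Pi.single i 1) (Pi.single m 1) hiu ∈ relElemSubgroup n I := by
    refine elemSubgroup_le_relElemSubgroup I (rankOneGL_single_right_mem_elemSubgroup _ _ _
      fun k => ?_)
    rw [← Ideal.Quotient.eq_zero_iff_mem, hu']
    simp [hu, Pi.single_apply, hmi, apply_ite (Ideal.Quotient.mk I)]
  have f4 : rankOneGL (Pi.single m 1) (v' - Pi.single j ξ) hvj ∈ relElemSubgroup n I := by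
    refine elemSubgroup_le_relElemSubgroup I (rankOneGL_single_left_mem_elemSubgroup _ _ _
      fun k => ?_)
    rw [← Ideal.Quotient.eq_zero_iff_mem, hv']
    simp [hu, Pi.single_apply, hij.symm, apply_ite (Ideal.Quotient.mk I)]
  rw [rankOneGL_congr rfl (sub_add_cancel v v').symm, rankOneGL_add_right _ _ _ hvv' hv'u,
    rankOneGL_congr (u := u) (v := v') (u' := u' + u m • Pi.single m 1)
      (by rw [hu', sub_add_cancel]) rfl, rankOneGL_add_left _ _ _ hv'u' hv's,
    ← commutator_rankOneGL u' v' m hu'm hv'm hv'u',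
    ← commutator_rankOneGL (Pi.single i 1) (Pi.single j ξ) m (by simp [hmi]) (by simp [hmj]),
    rankOneGL_congr (sub_add_cancel u' (Pi.single i 1)).symm rfl,
    rankOneGL_add_left _ _ _ hiu hie,
    rankOneGL_congr rfl (sub_add_cancel v' (Pi.single j ξ)).symm,
    rankOneGL_add_right _ _ _ hvj hej]
  rw [← QuotientGroup.eq_one_iff, ← QuotientGroup.mk'_apply] at f1 f2 f3 f4 ⊢
  simp only [map_div, map_mul, map_commutatorElement, f1, f2, f3, f4, one_mul, mul_one, div_self']

theorem commutator_elemTransvection_mem_relElemSubgroup (hn : 3 ≤ n) {I : Ideal R}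
    {g : GL (Fin n) R} (hg : g ∈ principalCongruenceSubgroup n I) (i j : Fin n) (hij : i ≠ j)
    (ξ : R) : ⁅g, elemTransvection i j hij ξ⁆ ∈ relElemSubgroup n I := by
  rw [commutatorElement_def, elemTransvection_eq_rankOneGL, conj_rankOneGL, ← div_eq_mul_inv]
  exact rankOneGL_div_rankOneGL_single_mem_relElemSubgroup hn _ _ _ i j hij ξ
    (inv_row_dotProduct_col g i) _ (mk_mulVec_single hg i) (mk_single_vecMul (inv_mem hg) ξ j)

theorem le_of_elemTransvection_mem {I : Ideal R} {H : Subgroup (GL (Fin n) R)} [H.Normal]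
    (h : ∀ (i j : Fin n) (hij : i ≠ j), ∀ ξ ∈ I, elemTransvection i j hij ξ ∈ H) :
    relElemSubgroup n I ≤ H := by
  have h1 : elemSubgroup n I ≤ H := by
    refine (Subgroup.closure_le _).2 ?_
    rintro _ ⟨i, j, hij, ξ, hξ, rfl⟩
    exact h i j hij ξ hξ
  refine (Subgroup.closure_le _).2 ?_
  rintro _ ⟨z, -, y, hy, rfl⟩
  exact Subgroup.Normal.conj_mem ‹_› y (h1 hy) z

instance (I : Ideal R) : (principalCongruenceSubgroup n I).Normal :=
  MonoidHom.normal_ker _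

instance (I : Ideal R) : (fullCongruenceSubgroup n I).Normal :=
  Subgroup.Normal.comap inferInstance _

theorem commutator_principalCongruenceSubgroup_le (hn : 3 ≤ n) (I : Ideal R) :
    ⁅principalCongruenceSubgroup n I, relElemSubgroup n (⊤ : Ideal R)⁆ ≤ relElemSubgroup n I := by
  have := relElemSubgroup_normal hn I
  refine Subgroup.commutator_le.2 fun g hg => ?_
  suffices relElemSubgroup n (⊤ : Ideal R) ≤
      (Subgroup.centralizer {(QuotientGroup.mk' (relElemSubgroup n I)) g}).comap
        (QuotientGroup.mk' (relElemSubgroup n I)) by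
    intro h hh
    have := Subgroup.mem_centralizer_singleton_iff.1 (this hh)
    rw [← QuotientGroup.eq_one_iff, ← QuotientGroup.mk'_apply, map_commutatorElement,
      commutatorElement_eq_one_iff_mul_comm, this]
  rw [relElemSubgroup_top]
  refine (Subgroup.closure_le _).2 ?_
  rintro _ ⟨i, j, hij, ξ, -, rfl⟩
  refine Subgroup.mem_centralizer_singleton_iff.2 ?_
  have := commutator_elemTransvection_mem_relElemSubgroup hn hg i j hij ξ
  rw [← QuotientGroup.eq_one_iff, ← QuotientGroup.mk'_apply, map_commutatorElement,
      commutatorElement_eq_one_iff_mul_comm] at this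
  exact this.symm

end Congruence

/-- The three subgroups lemma modulo a normal subgroup. -/
theorem Subgroup.commutator_commutator_le_of_rotate {G : Type*} [Group G] {H₁ H₂ H₃ N : Subgroup G}
    [N.Normal] (h1 : ⁅⁅H₂, H₃⁆, H₁⁆ ≤ N) (h2 : ⁅⁅H₃, H₁⁆, H₂⁆ ≤ N) : ⁅⁅H₁, H₂⁆, H₃⁆ ≤ N := by
  have key : ∀ K : Subgroup G, K ≤ N ↔ K.map (QuotientGroup.mk' N) = ⊥ := fun K => by
    rw [Subgroup.map_eq_bot_iff, QuotientGroup.ker_mk']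
  simp only [key, Subgroup.map_commutator] at *
  exact Subgroup.commutator_commutator_eq_bot_of_rotate h1 h2

/-! ### Commutator formulas and the centraliser -/

section Main

variable {R : Type*} [CommRing R] {n : ℕ}

theorem mem_fullCongruenceSubgroup_iff {I : Ideal R} {g : GL (Fin n) R} :
    g ∈ fullCongruenceSubgroup n I ↔
      ∃ c : R, ∀ i j, ((g : Matrix (Fin n) (Fin n) R) - scalar (Fin n) c) i j ∈ I := by
  rw [fullCongruenceSubgroup, Subgroup.mem_comap,
    Matrix.GeneralLinearGroup.mem_center_iff_val_mem_range_scalar, Set.mem_range,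
    Ideal.Quotient.mk_surjective.exists]
  refine exists_congr fun c => ?_
  rw [← Matrix.ext_iff]
  refine forall₂_congr fun i j => ?_
  rw [← Ideal.Quotient.eq_zero_iff_mem, Matrix.sub_apply, map_sub, sub_eq_zero, eq_comm]
  simp [Matrix.diagonal_apply, apply_ite (Ideal.Quotient.mk I)]

theorem mem_principalCongruenceSubgroup_iff {I : Ideal R} {g : GL (Fin n) R} :
    g ∈ principalCongruenceSubgroup n I ↔
      ∀ i j, ((g : Matrix (Fin n) (Fin n) R) - 1) i j ∈ I := by
  rw [principalCongruenceSubgroup, MonoidHom.mem_ker, Units.ext_iff, ← Matrix.ext_iff]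
  refine forall₂_congr fun i j => ?_
  rw [← Ideal.Quotient.eq_zero_iff_mem, Matrix.sub_apply, map_sub, sub_eq_zero]
  simp [Matrix.one_apply, apply_ite (Ideal.Quotient.mk I)]

theorem commutator_mem_principalCongruenceSubgroup_iff {I : Ideal R} {g h : GL (Fin n) R} :
    ⁅g, h⁆ ∈ principalCongruenceSubgroup n I ↔
      ∀ i j, ((g : Matrix (Fin n) (Fin n) R) * h - h * g) i j ∈ I := by
  rw [principalCongruenceSubgroup, MonoidHom.mem_ker, map_commutatorElement,
    commutatorElement_eq_one_iff_mul_comm, ← map_mul, ← map_mul, Units.ext_iff, ← Matrix.ext_iff]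
  refine forall₂_congr fun i j => ?_
  rw [← Ideal.Quotient.eq_zero_iff_mem, Matrix.sub_apply, map_sub, sub_eq_zero]
  rfl

theorem commutator_fullCongruenceSubgroup_principalCongruenceSubgroup_le (I J : Ideal R) :
    ⁅fullCongruenceSubgroup n I, principalCongruenceSubgroup n J⁆ ≤
      principalCongruenceSubgroup n (I * J) := by
  refine Subgroup.commutator_le.2 fun g hg h hh => ?_
  rw [commutator_mem_principalCongruenceSubgroup_iff]
  obtain ⟨c, hc⟩ := mem_fullCongruenceSubgroup_iff.1 hg
  rw [mem_principalCongruenceSubgroup_iff] at hh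
  -- Subtracting the central matrices c and 1 leaves the commutator unchanged and puts a factor from
  -- I and one from J in each term.
  have key : (g : Matrix (Fin n) (Fin n) R) * h - h * g =
      ((g : Matrix (Fin n) (Fin n) R) - scalar (Fin n) c) * (h - 1) -
        (h - 1) * ((g : Matrix (Fin n) (Fin n) R) - scalar (Fin n) c) := by
    have := (scalar_commute c (fun r => mul_comm c r) (h : Matrix (Fin n) (Fin n) R)).eq
    simp only [sub_mul, mul_sub, this, mul_one, one_mul]
    abel
  intro i j
  rw [key, Matrix.sub_apply, mul_apply, mul_apply]
  refine sub_mem (sum_mem fun k _ => Ideal.mul_mem_mul (hc _ _) (hh _ _))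
    (sum_mem fun k _ => ?_)
  exact mul_comm I J ▸ Ideal.mul_mem_mul (hh _ _) (hc _ _)

theorem relElemSubgroup_le_principalCongruenceSubgroup (I : Ideal R) :
    relElemSubgroup n I ≤ principalCongruenceSubgroup n I := by
  refine le_of_elemTransvection_mem fun i j hij ξ hξ => ?_
  rw [mem_principalCongruenceSubgroup_iff]
  intro k l
  simp only [elemTransvection, transvection, add_sub_cancel_left, single_apply]
  split_ifs
  exacts [hξ, zero_mem I]

theorem principalCongruenceSubgroup_mono {I J : Ideal R} (h : I ≤ J) :
    principalCongruenceSubgroup n I ≤ principalCongruenceSubgroup n J := fun g hg => by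
  rw [mem_principalCongruenceSubgroup_iff] at *
  exact fun i j => h (hg i j)

theorem principalCongruenceSubgroup_le_fullCongruenceSubgroup (I : Ideal R) :
    principalCongruenceSubgroup n I ≤ fullCongruenceSubgroup n I := fun g hg =>
  mem_fullCongruenceSubgroup_iff.2 ⟨1, by
    rw [map_one]; exact mem_principalCongruenceSubgroup_iff.1 hg⟩

theorem commutator_elemTransvection {i j k : Fin n} (hij : i ≠ j) (hik : i ≠ k) (hkj : k ≠ j)
    (a b : R) : ⁅elemTransvection i k hik a, elemTransvection k j hkj b⁆ =
      elemTransvection i j hij (a * b) := by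
  have h1 : (Pi.single k a : Fin n → R) = a • Pi.single k 1 := by rw [← Pi.single_smul]; simp
  have h2 : (Pi.single j (a * b) : Fin n → R) = a • Pi.single j b := by
    rw [← Pi.single_smul]; simp
  rw [elemTransvection_eq_rankOneGL, elemTransvection_eq_rankOneGL,
    elemTransvection_eq_rankOneGL, rankOneGL_congr rfl h1,
    ← rankOneGL_smul_left _ _ _ (by simp [hik]),
    commutator_rankOneGL _ _ k (by simp [hik.symm]) (by simp [hkj]) (by simp [hij]),
    rankOneGL_smul_left _ _ _ (by simp [hij]), rankOneGL_congr rfl h2]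

theorem elemTransvection_add (i j : Fin n) (hij : i ≠ j) (a b : R) :
    elemTransvection i j hij (a + b) =
      elemTransvection i j hij a * elemTransvection i j hij b := by
  ext1
  exact (transvection_mul_transvection_same i j hij a b).symm

theorem relElemSubgroup_mul_le (hn : 3 ≤ n) (I J : Ideal R) :
    relElemSubgroup n (I * J) ≤ ⁅relElemSubgroup n I, relElemSubgroup n J⁆ := by
  have := relElemSubgroup_normal hn I
  have := relElemSubgroup_normal hn J
  refine le_of_elemTransvection_mem fun i j hij ξ hξ => ?_
  obtain ⟨k, hki, hkj⟩ := exists_ne_ne hn i j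
  refine Submodule.mul_induction_on hξ (fun a ha b hb => ?_) fun a b ha hb => ?_
  · rw [← commutator_elemTransvection hij hki.symm hkj]
    exact Subgroup.commutator_mem_commutator
      (elemSubgroup_le_relElemSubgroup I (elemTransvection_mem_elemSubgroup _ _ _ ha))
      (elemSubgroup_le_relElemSubgroup J (elemTransvection_mem_elemSubgroup _ _ _ hb))
  · rw [elemTransvection_add]
    exact mul_mem ha hb

/-- Three subgroups lemma for E(n,R), E(n,R,J), C(n,R,I): one rotated term is `hI`, the other lies
in [GL(n,R,IJ), E(n,R)] ≤ E(n,R,IJ). -/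
theorem commutator_fullCongruenceSubgroup_relElemSubgroup_le_of_top (hn : 3 ≤ n) (I J : Ideal R)
    (N : Subgroup (GL (Fin n) R)) [N.Normal] (hN : relElemSubgroup n (I * J) ≤ N)
    (hI : ⁅⁅fullCongruenceSubgroup n I, relElemSubgroup n (⊤ : Ideal R)⁆,
      relElemSubgroup n J⁆ ≤ N) :
    ⁅fullCongruenceSubgroup n I, relElemSubgroup n J⁆ ≤ N := by
  have h1 : relElemSubgroup n J ≤ ⁅relElemSubgroup n (⊤ : Ideal R), relElemSubgroup n J⁆ := by
    simpa using relElemSubgroup_mul_le hn ⊤ J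
  rw [Subgroup.commutator_comm]
  refine (Subgroup.commutator_mono h1 le_rfl).trans
    (Subgroup.commutator_commutator_le_of_rotate ?_ hI)
  rw [Subgroup.commutator_comm (relElemSubgroup n J)]
  exact (Subgroup.commutator_mono ((Subgroup.commutator_mono le_rfl
    (relElemSubgroup_le_principalCongruenceSubgroup J)).trans
    (commutator_fullCongruenceSubgroup_principalCongruenceSubgroup_le I J)) le_rfl).trans
    ((commutator_principalCongruenceSubgroup_le hn _).trans hN)

/-- The absolute standard commutator formula. -/
theorem commutator_fullCongruenceSubgroup_relElemSubgroup_top_le (hn : 3 ≤ n) (I : Ideal R) :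
    ⁅fullCongruenceSubgroup n I, relElemSubgroup n (⊤ : Ideal R)⁆ ≤ relElemSubgroup n I := by
  have := relElemSubgroup_normal hn I
  -- For J = R the inner commutator is already in GL(n,R,I), so the principal congruence case
  -- applies.
  refine commutator_fullCongruenceSubgroup_relElemSubgroup_le_of_top hn I ⊤ _ (by simp) ?_
  refine (Subgroup.commutator_mono ((Subgroup.commutator_mono le_rfl
    (relElemSubgroup_le_principalCongruenceSubgroup ⊤)).trans
    (commutator_fullCongruenceSubgroup_principalCongruenceSubgroup_le I ⊤)) le_rfl).trans ?_
  rw [Ideal.mul_top]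
  exact commutator_principalCongruenceSubgroup_le hn I

/-- The birelative standard commutator formula. -/
theorem commutator_fullCongruenceSubgroup_relElemSubgroup_le (hn : 3 ≤ n) (I J : Ideal R) :
    ⁅fullCongruenceSubgroup n I, relElemSubgroup n J⁆ ≤
      ⁅relElemSubgroup n I, relElemSubgroup n J⁆ := by
  have := relElemSubgroup_normal hn I
  have := relElemSubgroup_normal hn J
  exact commutator_fullCongruenceSubgroup_relElemSubgroup_le_of_top hn I J _
    (relElemSubgroup_mul_le hn I J)
    (Subgroup.commutator_mono (commutator_fullCongruenceSubgroup_relElemSubgroup_top_le hn I)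
      le_rfl)

theorem commutator_relElemSubgroup_colon_le (A B : Ideal R) :
    ⁅relElemSubgroup n (B.colon (A : Set R)), relElemSubgroup n A⁆ ≤
      principalCongruenceSubgroup n B :=
  (Subgroup.commutator_mono ((relElemSubgroup_le_principalCongruenceSubgroup _).trans
    (principalCongruenceSubgroup_le_fullCongruenceSubgroup _))
    (relElemSubgroup_le_principalCongruenceSubgroup A)).trans
    ((commutator_fullCongruenceSubgroup_principalCongruenceSubgroup_le _ _).trans
      (principalCongruenceSubgroup_mono (Ideal.mul_le.2 fun _ hr a ha =>
        Submodule.mem_colon.1 hr a ha)))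

theorem mem_fullCongruenceSubgroup_colon {A B : Ideal R} {g : GL (Fin n) R}
    (h : ∀ (i j : Fin n) (hij : i ≠ j), ∀ a ∈ A,
      ⁅elemTransvection i j hij a, g⁆ ∈ principalCongruenceSubgroup n B) :
    g ∈ fullCongruenceSubgroup n (B.colon (A : Set R)) := by
  rw [fullCongruenceSubgroup, Subgroup.mem_comap,
    Matrix.GeneralLinearGroup.mem_center_iff_val_mem_range_scalar]
  -- A matrix commuting with all off-diagonal matrix units is scalar; letting a run over A turns
  -- congruences modulo B into congruences modulo (B:A).
  refine mem_range_scalar_of_commute_single fun i j hij => ?_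
  have key : ∀ k l, (single i j 1 * (g : Matrix (Fin n) (Fin n) R) -
      (g : Matrix (Fin n) (Fin n) R) * single i j 1 : Matrix (Fin n) (Fin n) R) k l ∈
      B.colon (A : Set R) := by
    intro k l
    refine Submodule.mem_colon.2 fun a ha => ?_
    have := commutator_mem_principalCongruenceSubgroup_iff.1 (h i j hij a ha) k l
    have e : ((elemTransvection i j hij a : GL (Fin n) R) : Matrix (Fin n) (Fin n) R) =
        1 + a • single i j 1 := by
      simp [elemTransvection, transvection, smul_single]
    rw [e, add_mul, mul_add, one_mul, mul_one, add_sub_add_left_eq_sub, smul_mul_assoc,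
      mul_smul_comm, ← smul_sub, Matrix.smul_apply] at this
    rwa [smul_eq_mul, mul_comm]
  ext k l
  have := key k l
  rw [← Ideal.Quotient.eq_zero_iff_mem, Matrix.sub_apply, map_sub, sub_eq_zero] at this
  simpa [mul_apply, single_apply, apply_ite (Ideal.Quotient.mk (B.colon (A : Set R)))] using this

end Main

theorem theorem2 {R : Type*} [CommRing R] (A B : Ideal R) (n : ℕ) (hn : 3 ≤ n) :
    centraliserMod (relElemSubgroup n A)
        ⁅relElemSubgroup n (B.colon (A : Set R)), relElemSubgroup n A⁆ =
      (fullCongruenceSubgroup n (B.colon (A : Set R)) :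
        Set (Matrix.GeneralLinearGroup (Fin n) R)) := by
  refine Set.Subset.antisymm (fun g hg => ?_) fun g hg f hf => ?_
  · exact mem_fullCongruenceSubgroup_colon fun i j hij a ha =>
      commutator_relElemSubgroup_colon_le A B (hg _ (elemSubgroup_le_relElemSubgroup A
        (elemTransvection_mem_elemSubgroup i j hij ha)))
  · refine commutator_fullCongruenceSubgroup_relElemSubgroup_le hn _ A ?_
    rw [Subgroup.commutator_comm]
    exact Subgroup.commutator_mem_commutator hf hg
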